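/- Let $S$ be a countable semigroup, and let $\ell^1(S)$ be the complex Banach algebra of absolutely summable functions $a:S\to\mathbb C$, with norm $\|a\|=\sum_{s}|a_s|$ and convolution product determined by $\delta_s\delta_t=\delta_{st}$. Its dual is $\ell^1(S)^*=\ell^\infty(S)$, via $\langle f,a\rangle=\sum_s f(s)a_s$. A *predual* of $\ell^1(S)$ is a closed linear subspace $E\subseteq\ell^1(S)^*$ such that - $E$ is a sub-bimodule of $\ell^1(S)^*$: for all $f\in E$ and $a\in\ell^1(S)$, the functionals $b\mapsto\langle f,ab\rangle$ and $b\mapsto\langle f,ba\rangle$ belong to $E$; - the canonical map $\ell^1(S)\to E^*$, $a\mapsto(f\mapsto\langle f,a\rangle)$, is an isomorphism of Banach spaces (a linear homeomorphism onto $E^*$). Let $\sigma$ be a locally compact Hausdorff topology on $S$, and let $C_0(S,\sigma)\subseteq\ell^\infty(S)=\ell^1(S)^*$ be the space of continuous complex functions on $(S,\sigma)$ that vanish at infinity. Then $C_0(S,\sigma)$ is a predual of $\ell^1(S)$ if and only if the following two conditions hold: 1. $(S,\sigma)$ is a semitopological semigroup, i.e. for each $s\in S$ the maps $t\mapsto st$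 and $t\mapsto ts$ are continuous; 2. whenever $s\in S$ and $(t_n)_{n\ge 1}$ is a sequence in $S$ such that at least one of the sequences $(t_ns)_n$, $(st_n)_n$ has a subsequence converging in $(S,\sigma)$, the sequence $(t_n)_n$ itself has a subsequence converging in $(S,\sigma)$. -/

import Mathlib

set_option maxSynthPendingDepth 3

open Filter Topology

noncomputable section

/-- The Banach space `ℓ¹(S)` of absolutely summable complex functions on `S`, with the norm
`‖a‖ = ∑ |a_s|`. It is a type of its own (and not just `lp _ 1`) because it carries the
convolution product. -/
def SemigroupL1 (S : Type*) : Type _ := lp (fun _ : S => ℂ) 1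

namespace SemigroupL1

variable {S : Type*}

instance : NormedAddCommGroup (SemigroupL1 S) :=
  inferInstanceAs (NormedAddCommGroup (lp (fun _ : S => ℂ) 1))

instance : NormedSpace ℂ (SemigroupL1 S) :=
  inferInstanceAs (NormedSpace ℂ (lp (fun _ : S => ℂ) 1))

instance : CompleteSpace (SemigroupL1 S) :=
  inferInstanceAs (CompleteSpace (lp (fun _ : S => ℂ) 1))

instance : CoeFun (SemigroupL1 S) (fun _ => S → ℂ) :=
  ⟨fun a => (a : lp (fun _ : S => ℂ) 1).1⟩

theorem ext {a b : SemigroupL1 S} (h : ∀ s, a s = b s) : a = b :=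
  Subtype.ext (funext h)

theorem add_apply (a b : SemigroupL1 S) (s : S) : (a + b) s = a s + b s := rfl

theorem smul_apply (c : ℂ) (a : SemigroupL1 S) (s : S) : (c • a) s = c * a s := rfl

theorem summable_norm (a : SemigroupL1 S) : Summable fun s => ‖a s‖ := by
  simpa using (lp.memℓp (a : lp (fun _ : S => ℂ) 1)).summable (by simp)

theorem norm_eq_tsum (a : SemigroupL1 S) : ‖a‖ = ∑' s, ‖a s‖ := by
  have h := lp.norm_eq_tsum_rpow (p := 1) (by simp) (a : lp (fun _ : S => ℂ) 1)
  simp only [ENNReal.toReal_one, Real.rpow_one, one_div, inv_one] at h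
  exact h

/-- Any absolutely summable function is an element of `ℓ¹(S)`. -/
def mk (f : S → ℂ) (hf : Summable fun s => ‖f s‖) : SemigroupL1 S :=
  (⟨f, memℓp_gen (by simpa using hf)⟩ : lp (fun _ : S => ℂ) 1)

theorem mk_apply (f : S → ℂ) (hf : Summable fun s => ‖f s‖) (s : S) : mk f hf s = f s := rfl

/-- The standard unit vector `δ_s`. -/
def delta (s : S) : SemigroupL1 S :=
  open Classical in lp.single (E := fun _ : S => ℂ) 1 s (1 : ℂ)

open Classical in
theorem delta_apply (s t : S) : delta s t = if t = s then 1 else 0 := by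
  by_cases hts : t = s
  · subst hts; simp [delta]
  · simp [delta, hts]

theorem hasSum_delta (a : SemigroupL1 S) : HasSum (fun s => a s • delta s) a := by
  classical
  have h := lp.hasSum_single (p := 1) (by simp) (a : lp (fun _ : S => ℂ) 1)
  have h2 : (fun s => a s • delta s) = fun s => lp.single (E := fun _ : S => ℂ) 1 s (a s) := by
    funext s
    apply ext
    intro t
    rw [smul_apply, delta_apply]
    by_cases hts : t = s
    · subst hts; simp
    · simp [hts]
  rw [h2]
  exact h

/-- Two continuous linear maps on `ℓ¹(S)` that agree on the unit vectors are equal. -/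
theorem clm_ext {F : Type*} [NormedAddCommGroup F] [NormedSpace ℂ F]
    {f g : SemigroupL1 S →L[ℂ] F} (h : ∀ s, f (delta s) = g (delta s)) : f = g := by
  ext a
  have hf := (hasSum_delta a).mapL f
  have hg := (hasSum_delta a).mapL g
  simp only [map_smul, h] at hf hg
  exact hf.unique hg

theorem summable_prod_norm (a b : SemigroupL1 S) :
    Summable fun p : S × S => ‖a p.1 * b p.2‖ :=
  (summable_norm a).mul_norm (summable_norm b)

section Convolution

variable [Semigroup S]

theorem summable_sigma_norm (a b : SemigroupL1 S) :
    Summable fun q : (Σ u : S, {p : S × S // p.1 * p.2 = u}) =>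
      ‖a q.2.1.1 * b q.2.1.2‖ :=
  (Equiv.sigmaFiberEquiv (fun p : S × S => p.1 * p.2)).summable_iff.2 (summable_prod_norm a b)

theorem summable_fiber_norm (a b : SemigroupL1 S) (u : S) :
    Summable fun p : {p : S × S // p.1 * p.2 = u} => ‖a p.1.1 * b p.1.2‖ :=
  (summable_sigma_norm a b).sigma_factor u

theorem norm_conv_le (a b : SemigroupL1 S) (u : S) :
    ‖∑' p : {p : S × S // p.1 * p.2 = u}, a p.1.1 * b p.1.2‖ ≤
      ∑' p : {p : S × S // p.1 * p.2 = u}, ‖a p.1.1 * b p.1.2‖ :=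
  norm_tsum_le_tsum_norm (summable_fiber_norm a b u)

theorem summable_conv (a b : SemigroupL1 S) :
    Summable fun u : S => ‖∑' p : {p : S × S // p.1 * p.2 = u}, a p.1.1 * b p.1.2‖ :=
  Summable.of_nonneg_of_le (fun _ => norm_nonneg _) (norm_conv_le a b)
    (summable_sigma_norm a b).sigma

/-- Convolution: `(a * b)_u = ∑_{st = u} a_s b_t`. -/
instance : Mul (SemigroupL1 S) where
  mul a b := mk (fun u => ∑' p : {p : S × S // p.1 * p.2 = u}, a p.1.1 * b p.1.2)
    (summable_conv a b)

theorem mul_apply (a b : SemigroupL1 S) (u : S) :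
    (a * b) u = ∑' p : {p : S × S // p.1 * p.2 = u}, a p.1.1 * b p.1.2 := rfl

theorem norm_mul_le' (a b : SemigroupL1 S) : ‖a * b‖ ≤ ‖a‖ * ‖b‖ := by
  have h1 : ‖a * b‖ ≤ ∑' u : S, ∑' p : {p : S × S // p.1 * p.2 = u}, ‖a p.1.1 * b p.1.2‖ := by
    rw [norm_eq_tsum]
    exact (summable_conv a b).tsum_le_tsum (norm_conv_le a b) (summable_sigma_norm a b).sigma
  have h2 : ∑' u : S, ∑' p : {p : S × S // p.1 * p.2 = u}, ‖a p.1.1 * b p.1.2‖ =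
      ∑' p : S × S, ‖a p.1 * b p.2‖ := by
    rw [← (Equiv.sigmaFiberEquiv (fun p : S × S => p.1 * p.2)).tsum_eq
      (fun p : S × S => ‖a p.1 * b p.2‖)]
    exact (summable_sigma_norm a b).tsum_sigma.symm
  have h3 : ∑' p : S × S, ‖a p.1 * b p.2‖ = ‖a‖ * ‖b‖ := by
    rw [norm_eq_tsum a, norm_eq_tsum b,
      tsum_mul_tsum_of_summable_norm (by simpa using summable_norm a)
        (by simpa using summable_norm b)]
    simp
  exact h1.trans (h2.trans h3).le

theorem add_mul' (a b c : SemigroupL1 S) : (a + b) * c = a * c + b * c := by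
  apply ext
  intro u
  rw [add_apply, mul_apply, mul_apply, mul_apply,
    ← (summable_fiber_norm a c u).of_norm.tsum_add (summable_fiber_norm b c u).of_norm]
  exact tsum_congr fun p => by rw [add_apply, add_mul]

theorem mul_add' (a b c : SemigroupL1 S) : a * (b + c) = a * b + a * c := by
  apply ext
  intro u
  rw [add_apply, mul_apply, mul_apply, mul_apply,
    ← (summable_fiber_norm a b u).of_norm.tsum_add (summable_fiber_norm a c u).of_norm]
  exact tsum_congr fun p => by rw [add_apply, mul_add]

theorem smul_mul' (k : ℂ) (a b : SemigroupL1 S) : (k • a) * b = k • (a * b) := by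
  apply ext
  intro u
  rw [smul_apply, mul_apply, mul_apply, ← tsum_mul_left]
  exact tsum_congr fun p => by rw [smul_apply, mul_assoc]

theorem mul_smul' (k : ℂ) (a b : SemigroupL1 S) : a * (k • b) = k • (a * b) := by
  apply ext
  intro u
  rw [smul_apply, mul_apply, mul_apply, ← tsum_mul_left]
  exact tsum_congr fun p => by rw [smul_apply, mul_left_comm]

theorem delta_mul_delta (s t : S) : delta s * delta t = delta (s * t) := by
  classical
  apply ext
  intro u
  rw [mul_apply, delta_apply]
  by_cases hu : u = s * t
  · subst hu
    rw [tsum_eq_single ⟨(s, t), rfl⟩]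
    · simp [delta_apply]
    · rintro ⟨⟨x, y⟩, hxy⟩ hne
      simp only [delta_apply]
      by_cases hx : x = s
      · by_cases hy : y = t
        · subst hx; subst hy; exact absurd rfl hne
        · simp [hy]
      · simp [hx]
  · rw [if_neg hu]
    refine (tsum_congr ?_).trans tsum_zero
    rintro ⟨⟨x, y⟩, hxy⟩
    simp only [delta_apply]
    by_cases hx : x = s
    · by_cases hy : y = t
      · subst hx; subst hy; exact absurd hxy.symm hu
      · simp [hy]
    · simp [hx]

/-- Convolution as a bounded bilinear map. -/
def mulL : SemigroupL1 S →L[ℂ] SemigroupL1 S →L[ℂ] SemigroupL1 S :=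
  LinearMap.mkContinuous₂ (LinearMap.mk₂ ℂ (fun a b => a * b) add_mul' smul_mul' mul_add'
    mul_smul') 1 (fun a b => by simpa using norm_mul_le' a b)

theorem mulL_apply (a b : SemigroupL1 S) : mulL a b = a * b := rfl

theorem mul_assoc' (a b c : SemigroupL1 S) : a * b * c = a * (b * c) := by
  have h1 (s t : S) (c : SemigroupL1 S) : delta s * delta t * c = delta s * (delta t * c) := by
    have : mulL (delta s * delta t) = (mulL (delta s)).comp (mulL (delta t)) :=
      clm_ext fun u => by simp [mulL_apply, delta_mul_delta, _root_.mul_assoc]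
    exact DFunLike.congr_fun this c
  have h2 (s : S) (b c : SemigroupL1 S) : delta s * b * c = delta s * (b * c) := by
    have : (mulL.flip c).comp (mulL (delta s)) = (mulL (delta s)).comp (mulL.flip c) :=
      clm_ext fun u => by simpa [mulL_apply] using h1 s u c
    exact DFunLike.congr_fun this b
  have : (mulL.flip c).comp (mulL.flip b) = mulL.flip (b * c) :=
    clm_ext fun u => by simpa [mulL_apply] using h2 u b c
  exact DFunLike.congr_fun this a

/-- `ℓ¹(S)` with convolution is a (complex, not necessarily unital) Banach algebra. -/
instance : NonUnitalNormedRing (SemigroupL1 S) where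
  __ := (inferInstance : NormedAddCommGroup (SemigroupL1 S))
  __ := (inferInstance : Mul (SemigroupL1 S))
  left_distrib := mul_add'
  right_distrib := add_mul'
  zero_mul a := by
    have h := smul_mul' 0 (0 : SemigroupL1 S) a
    rwa [zero_smul, zero_smul] at h
  mul_zero a := by
    have h := mul_smul' 0 a (0 : SemigroupL1 S)
    rwa [zero_smul, zero_smul] at h
  mul_assoc := mul_assoc'
  norm_mul_le := norm_mul_le'

instance : IsScalarTower ℂ (SemigroupL1 S) (SemigroupL1 S) := ⟨smul_mul'⟩

instance : SMulCommClass ℂ (SemigroupL1 S) (SemigroupL1 S) :=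
  ⟨fun k a b => (mul_smul' k a b).symm⟩

end Convolution

section C0

variable [TopologicalSpace S]

theorem norm_mul_apply_le (f : ZeroAtInftyContinuousMap S ℂ) (a : SemigroupL1 S) (s : S) :
    ‖a s * f s‖ ≤ ‖a s‖ * ‖f‖ := by
  rw [norm_mul]
  exact mul_le_mul_of_nonneg_left (f.toBCF.norm_coe_le_norm s) (norm_nonneg _)

theorem summable_mul_apply (f : ZeroAtInftyContinuousMap S ℂ) (a : SemigroupL1 S) :
    Summable fun s => ‖a s * f s‖ :=
  Summable.of_nonneg_of_le (fun _ => norm_nonneg _) (norm_mul_apply_le f a)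
    ((summable_norm a).mul_right _)

/-- The functional `a ↦ ∑ a_s f(s)` on `ℓ¹(S)` given by `f ∈ C₀(S)`, that is, `f` seen as an
element of `ℓ^∞(S) = ℓ¹(S)^*`. -/
def ofC0 (f : ZeroAtInftyContinuousMap S ℂ) : StrongDual ℂ (SemigroupL1 S) :=
  LinearMap.mkContinuous
    { toFun := fun a => ∑' s, a s * f s
      map_add' := fun a b => by
        rw [← (summable_mul_apply f a).of_norm.tsum_add (summable_mul_apply f b).of_norm]
        exact tsum_congr fun s => by rw [add_apply, add_mul]
      map_smul' := fun c a => by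
        rw [RingHom.id_apply, smul_eq_mul, ← tsum_mul_left]
        exact tsum_congr fun s => by rw [smul_apply, mul_assoc] }
    ‖f‖ (fun a => by
      refine (norm_tsum_le_tsum_norm (summable_mul_apply f a)).trans ?_
      rw [norm_eq_tsum, mul_comm, ← tsum_mul_right]
      exact (summable_mul_apply f a).tsum_le_tsum (norm_mul_apply_le f a)
        ((summable_norm a).mul_right _))

theorem ofC0_apply (f : ZeroAtInftyContinuousMap S ℂ) (a : SemigroupL1 S) :
    ofC0 f a = ∑' s, a s * f s := rfl

/-- `C₀(S, σ)`, for the topology `σ` that `S` carries, as a linear subspace of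
`ℓ^∞(S) = ℓ¹(S)^*`. -/
def c0Subspace (S : Type*) [TopologicalSpace S] :
    Submodule ℂ (StrongDual ℂ (SemigroupL1 S)) where
  carrier := Set.range ofC0
  zero_mem' := ⟨0, by ext a; simp [ofC0_apply]⟩
  add_mem' := by
    rintro _ _ ⟨f, rfl⟩ ⟨g, rfl⟩
    refine ⟨f + g, ?_⟩
    ext a
    rw [_root_.add_apply, ofC0_apply, ofC0_apply, ofC0_apply,
      ← (summable_mul_apply f a).of_norm.tsum_add (summable_mul_apply g a).of_norm]
    exact tsum_congr fun s => by simp [mul_add]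
  smul_mem' := by
    rintro c _ ⟨f, rfl⟩
    refine ⟨c • f, ?_⟩
    ext a
    rw [_root_.smul_apply, smul_eq_mul, ofC0_apply, ofC0_apply, ← tsum_mul_left]
    exact tsum_congr fun s => by simp [mul_left_comm]

end C0

end SemigroupL1

/-- A subspace `E` of the dual `A^*` of a Banach algebra `A` is a *predual* of `A` if it is closed,
is a sub-bimodule of `A^*` for the actions `⟨f · a, b⟩ = ⟨f, ab⟩` and `⟨a · f, b⟩ = ⟨f, ba⟩`, and is
a Banach space predual: the canonical map `A → E^*`, `a ↦ (f ↦ ⟨f, a⟩)`, is an isomorphism of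
Banach spaces. -/
structure IsPredual {A : Type*} [NonUnitalNormedRing A] [NormedSpace ℂ A] [IsScalarTower ℂ A A]
    [SMulCommClass ℂ A A] (E : Submodule ℂ (StrongDual ℂ A)) : Prop where
  isClosed : IsClosed (E : Set (StrongDual ℂ A))
  comp_mul_mem : ∀ f ∈ E, ∀ a : A, f.comp (ContinuousLinearMap.mul ℂ A a) ∈ E
  comp_mul_flip_mem : ∀ f ∈ E, ∀ a : A, f.comp ((ContinuousLinearMap.mul ℂ A).flip a) ∈ E
  exists_equiv : ∃ e : A ≃L[ℂ] StrongDual ℂ E, ∀ (a : A) (f : E), e a f = f.1 a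

/-- The sequence `x` has a convergent subsequence. -/
def HasConvergentSubseq {X : Type*} [TopologicalSpace X] (x : ℕ → X) : Prop :=
  ∃ φ : ℕ → ℕ, StrictMono φ ∧ ∃ l : X, Tendsto (x ∘ φ) atTop (𝓝 l)

end

/-! Being a closed subspace and a Banach space predual is automatic. The sup norm makes `C₀(S)`
isometric to its image in `ℓ^∞(S)`, and a countable space carries only atomic measures, so `C₀(S)^*
= ℓ¹(S)`. Only the bimodule condition has content. By linearity and density it can be tested on the
`δ_s` (`forall_comp_mem_c0Subspace_iff`), where it says that composition with each translation
preserves `C₀(S)`. A self-map has this property iff it is continuous and proper, and properness can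
be phrased with sequences because a countable locally compact Hausdorff space is second countable
(`forall_comp_mem_C0_iff`).

The duality is proved without measures (`exists_forall_eq_ofC0`). Zorn's lemma gives a maximal open
`U` on which the functional is represented by an element of `ℓ¹(S)`. If `U` were not everything, its
complement would have a relatively isolated point by Baire, and the representation would extend over
that point. -/

open scoped ZeroAtInfty

/-! ### Vanishing at infinity as compactness of superlevel sets -/

section CocompactBounds

variable {S : Type*} [TopologicalSpace S]

namespace ZeroAtInftyContinuousMap

theorem norm_apply_le (f : C₀(S, ℂ)) (x : S) : ‖f x‖ ≤ ‖f‖ := f.toBCF.norm_coe_le_norm x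

theorem norm_le {f : C₀(S, ℂ)} {C : ℝ} (hC : 0 ≤ C) (h : ∀ x, ‖f x‖ ≤ C) : ‖f‖ ≤ C :=
  (BoundedContinuousFunction.norm_le (f := f.toBCF) hC).2 h

theorem isCompact_le_norm (f : C₀(S, ℂ)) {ε : ℝ} (hε : 0 < ε) : IsCompact {x | ε ≤ ‖f x‖} := by
  have h := f.zero_at_infty'.norm
  rw [norm_zero] at h
  obtain ⟨K, hK, hKs⟩ := mem_cocompact.1 (h.eventually (gt_mem_nhds hε))
  refine hK.of_isClosed_subset (isClosed_le continuous_const (map_continuous f).norm)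
    fun x hx => ?_
  by_contra hxK
  exact not_lt.2 hx (show ‖f x‖ < ε from hKs hxK)

theorem tendsto_cocompact_of_isCompact_le_norm {f : S → ℂ}
    (h : ∀ ε > 0, IsCompact {x | ε ≤ ‖f x‖}) : Tendsto f (cocompact S) (𝓝 0) := by
  rw [Metric.tendsto_nhds]
  intro ε hε
  filter_upwards [(h ε hε).compl_mem_cocompact] with x hx
  simpa using hx

end ZeroAtInftyContinuousMap

end CocompactBounds

/-! ### Countable locally compact Hausdorff spaces and their Urysohn functions -/

section CountableLocallyCompact

variable {S : Type*} [TopologicalSpace S] [T2Space S] [LocallyCompactSpace S]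

/-- A compactly supported `f` equal to 1 exactly at `x` pulls `𝓝 1` back to `𝓝 x`: inside the
compact support, the pulled back filter can cluster only at `x`. -/
theorem nhds_isCountablyGenerated_of_isGδ_singleton {x : S} (hx : IsGδ ({x} : Set S)) :
    (𝓝 x).IsCountablyGenerated := by
  obtain ⟨f, hf1, -, hfc, -⟩ := exists_continuous_one_zero_of_isCompact_of_isGδ
    (isCompact_singleton (x := x)) hx isClosed_empty (Set.disjoint_empty _)
  have hfx : ∀ y, f y = 1 ↔ y = x := fun y => by
    have : y ∈ ({x} : Set S) ↔ f y = 1 := by rw [hf1]; rfl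
    exact this.symm
  have h1 : 𝓝 x ≤ comap f (𝓝 1) := by
    rw [← map_le_iff_le_comap]
    have := f.continuous.tendsto x
    rwa [(hfx x).2 rfl] at this
  have h2 : comap f (𝓝 1) ≤ 𝓝 x := by
    refine hfc.isCompact.le_nhds_of_unique_clusterPt ?_ fun y _ hy => ?_
    · refine ⟨{r | r ≠ 0}, isOpen_ne.mem_nhds one_ne_zero, fun y hy => subset_tsupport _ hy⟩
    · have h3 : ClusterPt (f y) (𝓝 (1 : ℝ)) :=
        hy.map f.continuous.continuousAt tendsto_comap
      exact (hfx y).1 (eq_of_nhds_neBot h3)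
  rw [le_antisymm h1 h2]
  infer_instance

/-- Each singleton is the countable intersection of the complements of the other points, hence a Gδ.
This gives first countability, which for a countable space implies second countability. -/
theorem secondCountableTopology_of_countable_of_locallyCompact [Countable S] :
    SecondCountableTopology S := by
  have : FirstCountableTopology S := ⟨fun x => by
    refine nhds_isCountablyGenerated_of_isGδ_singleton ?_
    have : ({x} : Set S) = ⋂ y ∈ ({x} : Set S)ᶜ, {y}ᶜ := by
      ext z
      simp only [Set.mem_singleton_iff, Set.mem_iInter, Set.mem_compl_iff]
      exact ⟨fun h y hy hz => hy (hz.symm.trans h), fun h => by_contra fun hz => h z hz rfl⟩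
    rw [this]
    exact IsGδ.biInter (Set.to_countable _) fun y _ => isOpen_compl_singleton.isGδ⟩
  infer_instance

/-- A nonempty closed subset of a countable locally compact Hausdorff space has a
relatively isolated point. -/
theorem exists_isOpen_inter_eq_singleton [Countable S] {F : Set S} (hF : IsClosed F)
    (hne : F.Nonempty) : ∃ x, ∃ V : Set S, IsOpen V ∧ V ∩ F = {x} := by
  have : LocallyCompactSpace F := hF.isClosedEmbedding_subtypeVal.locallyCompactSpace
  have : Nonempty F := hne.to_subtype
  -- Baire: `F` is the union of its countably many closed singletons, so one of them has nonempty
  -- interior.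
  obtain ⟨x, y, hy⟩ := nonempty_interior_of_iUnion_of_closed (f := fun x : F => ({x} : Set F))
    (fun _ => isClosed_singleton) (Set.iUnion_of_singleton F)
  obtain ⟨W, hWx, hWo, hyW⟩ := mem_interior.1 hy
  obtain ⟨V, hVo, rfl⟩ := isOpen_induced_iff.1 hWo
  refine ⟨x, V, hVo, ?_⟩
  ext z
  constructor
  · rintro ⟨hzV, hzF⟩
    exact congrArg Subtype.val (hWx (a := ⟨z, hzF⟩) hzV)
  · rintro rfl
    have : y = x := hWx hyW
    subst this
    exact ⟨hyW, y.2⟩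

namespace ZeroAtInftyContinuousMap

/-- Urysohn functions in `C₀`. -/
theorem exists_bump {K U : Set S} (hK : IsCompact K) (hU : IsOpen U) (hKU : K ⊆ U) :
    ∃ χ : C₀(S, ℂ), (∀ x ∈ K, χ x = 1) ∧ (∀ x ∉ U, χ x = 0) ∧ (∀ x, ‖χ x‖ ≤ 1) ∧
      ∀ x, ‖1 - χ x‖ ≤ 1 := by
  obtain ⟨g, hg1, hg0, hgc, hg⟩ := exists_continuous_one_zero_of_isCompact hK hU.isClosed_compl
    (Set.disjoint_compl_right_iff_subset.2 hKU)
  refine ⟨⟨⟨fun x => (g x : ℂ), by fun_prop⟩, ?_⟩, fun x hx => ?_, fun x hx => ?_, fun x => ?_,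
    fun x => ?_⟩
  · have h := hgc.is_zero_at_infty
    have h2 := (Complex.continuous_ofReal.tendsto 0).comp h
    simpa [Function.comp_def] using h2
  · change (g x : ℂ) = 1
    rw [hg1 hx]; simp
  · change (g x : ℂ) = 0
    rw [hg0 hx]; simp
  · change ‖(g x : ℂ)‖ ≤ 1
    rw [Complex.norm_real, Real.norm_eq_abs, abs_le]
    constructor <;> linarith [(hg x).1, (hg x).2]
  · change ‖1 - (g x : ℂ)‖ ≤ 1
    rw [← Complex.ofReal_one, ← Complex.ofReal_sub, Complex.norm_real, Real.norm_eq_abs, abs_le]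
    constructor <;> linarith [(hg x).1, (hg x).2]

/-- Interpolation on a finite set by a function of norm at most one. -/
theorem exists_interpolation {U : Set S} (hU : IsOpen U) (G : Finset S) (hG : ∀ x ∈ G, x ∈ U)
    (u : S → ℂ) (hu : ∀ x, ‖u x‖ ≤ 1) :
    ∃ f : C₀(S, ℂ), (∀ x ∈ G, f x = u x) ∧ (∀ x ∉ U, f x = 0) ∧ ‖f‖ ≤ 1 := by
  classical
  -- Bumps vanishing off disjoint sets keep the norm at most one: at each point at most one term of
  -- the sum is nonzero.
  obtain ⟨V, hV, hVd⟩ := G.finite_toSet.t2_separation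
  have hb : ∀ x : G, ∃ χ : C₀(S, ℂ), χ x = 1 ∧ (∀ y ∉ V x ∩ U, χ y = 0) ∧ ∀ y, ‖χ y‖ ≤ 1 := by
    intro x
    obtain ⟨χ, h1, h0, hn, -⟩ := exists_bump (isCompact_singleton (x := (x : S)))
      ((hV x).2.inter hU) (by simpa using ⟨(hV x).1, hG x x.2⟩)
    exact ⟨χ, h1 x rfl, h0, hn⟩
  choose χ hχ1 hχ0 hχn using hb
  let f : C₀(S, ℂ) := ∑ x : G, u x • χ x
  have hf : ∀ y, f y = ∑ x : G, u x * χ x y := fun y => by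
    have h : ∀ T : Finset G, (∑ x ∈ T, u x • χ x) y = ∑ x ∈ T, u x * χ x y := fun T => by
      induction T using Finset.induction_on with
      | empty => simp
      | insert a T ha ih => simp [Finset.sum_insert ha, ih]
    exact h _
  have hsingle : ∀ (x : G) (y : S), y ∈ V x → f y = u x * χ x y := fun x y hy => by
    rw [hf]
    refine Finset.sum_eq_single x (fun z _ hz => ?_) (by simp)
    rw [hχ0 z y, mul_zero]
    exact fun h => Set.disjoint_left.1 (hVd z.2 x.2 fun h => hz (Subtype.ext h)) h.1 hy
  refine ⟨f, fun x hx => ?_, fun y hy => ?_, norm_le zero_le_one fun y => ?_⟩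
  · rw [hsingle ⟨x, hx⟩ x (hV x).1, hχ1 ⟨x, hx⟩, mul_one]
  · rw [hf]
    exact Finset.sum_eq_zero fun x _ => by rw [hχ0 x y fun h => hy h.2, mul_zero]
  · by_cases h : ∃ x : G, y ∈ V x
    · obtain ⟨x, hx⟩ := h
      rw [hsingle x y hx, norm_mul]
      exact mul_le_one₀ (hu x) (norm_nonneg _) (hχn x y)
    · push Not at h
      rw [hf, Finset.sum_eq_zero fun x _ => by rw [hχ0 x y fun h' => h x h'.1, mul_zero]]
      simp

end ZeroAtInftyContinuousMap

end CountableLocallyCompact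

/-! ### The pairing of `C₀(S)` with `ℓ¹(S)` -/

namespace SemigroupL1

theorem norm_delta_le {S : Type*} (s : S) : ‖delta s‖ ≤ 1 := by
  classical
  rw [norm_eq_tsum, tsum_eq_single s fun t ht => by rw [delta_apply, if_neg ht, norm_zero],
    delta_apply, if_pos rfl, norm_one]

section Pairing

variable {S : Type*} [TopologicalSpace S]

theorem norm_ofC0_le (f : C₀(S, ℂ)) : ‖ofC0 f‖ ≤ ‖f‖ :=
  LinearMap.mkContinuous_norm_le _ (norm_nonneg _) _

theorem ofC0_delta (f : C₀(S, ℂ)) (s : S) : ofC0 f (delta s) = f s := by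
  classical
  rw [ofC0_apply, tsum_eq_single s fun t ht => by rw [delta_apply, if_neg ht, zero_mul],
    delta_apply, if_pos rfl, one_mul]

theorem norm_ofC0 (f : C₀(S, ℂ)) : ‖ofC0 f‖ = ‖f‖ := by
  refine (norm_ofC0_le f).antisymm (ZeroAtInftyContinuousMap.norm_le (norm_nonneg _) fun s => ?_)
  rw [← ofC0_delta]
  exact (ofC0 f).le_of_opNorm_le_of_le le_rfl (norm_delta_le s) |>.trans_eq (mul_one _)

/-- The inclusion of `C₀(S)` into `ℓ^∞(S) = ℓ¹(S)^*` as a linear isometry. -/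
noncomputable def ofC0ₗᵢ (S : Type*) [TopologicalSpace S] :
    C₀(S, ℂ) →ₗᵢ[ℂ] StrongDual ℂ (SemigroupL1 S) where
  toFun := ofC0
  map_add' f g := by
    refine clm_ext fun s => ?_
    rw [_root_.add_apply, ofC0_delta, ofC0_delta, ofC0_delta]
    rfl
  map_smul' c f := by
    refine clm_ext fun s => ?_
    rw [_root_.smul_apply, ofC0_delta, ofC0_delta]
    rfl
  norm_map' := norm_ofC0

theorem mem_c0Subspace {g : StrongDual ℂ (SemigroupL1 S)} :
    g ∈ c0Subspace S ↔ ∃ f : C₀(S, ℂ), ofC0 f = g := Iff.rfl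

theorem isClosed_c0Subspace : IsClosed (c0Subspace S : Set (StrongDual ℂ (SemigroupL1 S))) :=
  (ofC0ₗᵢ S).isometry.isClosedEmbedding.isClosed_range

theorem ofC0_sub_apply (f g : C₀(S, ℂ)) (a : SemigroupL1 S) :
    ofC0 (f - g) a = ofC0 f a - ofC0 g a :=
  DFunLike.congr_fun (map_sub (ofC0ₗᵢ S) f g) a

theorem ofC0_congr {f : C₀(S, ℂ)} {a b : SemigroupL1 S} {U : Set S} (h : ∀ x ∈ U, a x = b x)
    (hf : ∀ x ∉ U, f x = 0) : ofC0 f a = ofC0 f b := by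
  rw [ofC0_apply, ofC0_apply]
  refine tsum_congr fun s => ?_
  by_cases hs : s ∈ U
  · rw [h s hs]
  · rw [hf s hs, mul_zero, mul_zero]

/-- The norm of an element of `ℓ¹(S)` supported in an open set `U` is determined by its pairing
with the functions in `C₀(S)` that vanish off `U`. -/
theorem norm_le_of_forall_norm_ofC0_le [T2Space S] [LocallyCompactSpace S] {U : Set S}
    (hU : IsOpen U) {a : SemigroupL1 S} (ha : ∀ x ∉ U, a x = 0) {C : ℝ}
    (h : ∀ f : C₀(S, ℂ), (∀ x ∉ U, f x = 0) → ‖f‖ ≤ 1 → ‖ofC0 f a‖ ≤ C) : ‖a‖ ≤ C := by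
  classical
  refine le_of_forall_pos_le_add fun ε hε => ?_
  obtain ⟨G, hG⟩ := ((tendsto_tsum_compl_atTop_zero fun s => ‖a s‖).eventually
    (gt_mem_nhds (half_pos hε))).exists
  -- The phase with `a s * u s = ‖a s‖`; division by zero makes it 0 where `a` vanishes. Each term
  -- outside `G` costs at most `2 * ‖a s‖`, hence the tail bound `ε / 2`.
  let u : S → ℂ := fun s => (‖a s‖ : ℂ) / a s
  have hu : ∀ s, ‖u s‖ ≤ 1 := fun s => by
    simpa [u] using div_self_le_one ‖a s‖
  obtain ⟨f, hf1, hf0, hfn⟩ := ZeroAtInftyContinuousMap.exists_interpolation hU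
    (G.filter (· ∈ U)) (fun x hx => (Finset.mem_filter.1 hx).2) u hu
  have hterm : ∀ s, ‖(‖a s‖ : ℂ) - a s * f s‖ ≤
      ({s | s ∉ G} : Set S).indicator (fun s => 2 * ‖a s‖) s := fun s => by
    by_cases hs : s ∈ G
    · rw [Set.indicator_of_notMem (by simpa using hs)]
      refine le_of_eq (norm_eq_zero.2 ?_)
      by_cases hsU : s ∈ U
      · rw [hf1 s (Finset.mem_filter.2 ⟨hs, hsU⟩)]
        by_cases h0 : a s = 0
        · simp [h0]
        · simp only [u]
          rw [mul_div_cancel₀ _ h0, sub_self]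
      · simp [ha s hsU]
    · rw [Set.indicator_of_mem (by simpa using hs)]
      refine (norm_sub_le _ _).trans ?_
      rw [Complex.norm_real, norm_norm, norm_mul, two_mul]
      gcongr
      exact mul_le_of_le_one_right (norm_nonneg _)
        ((ZeroAtInftyContinuousMap.norm_apply_le f s).trans hfn)
  have hsum1 : Summable fun s => (‖a s‖ : ℂ) := Complex.summable_ofReal.2 (summable_norm a)
  have hsum2 := (summable_mul_apply f a).of_norm
  have hkey : ‖(‖a‖ : ℂ) - ofC0 f a‖ ≤ ε := by
    rw [norm_eq_tsum, Complex.ofReal_tsum, ofC0_apply, ← hsum1.tsum_sub hsum2]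
    have hind := ((summable_norm a).mul_left 2).indicator {s | s ∉ G}
    refine (norm_tsum_le_tsum_norm (hind.of_nonneg_of_le (fun _ => norm_nonneg _) hterm)).trans ?_
    refine ((hind.of_nonneg_of_le (fun _ => norm_nonneg _) hterm).tsum_le_tsum hterm hind).trans ?_
    rw [← tsum_subtype, tsum_mul_left]
    have : ∑' s : {s | s ∉ G}, ‖a s‖ < ε / 2 := hG
    linarith
  have h1 := norm_sub_norm_le (‖a‖ : ℂ) (ofC0 f a)
  rw [Complex.norm_real, norm_norm] at h1
  linarith [h f hf0 hfn]

theorem eq_zero_of_forall_ofC0_eq_zero [T2Space S] [LocallyCompactSpace S] {U : Set S}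
    (hU : IsOpen U) {a : SemigroupL1 S} (ha : ∀ x ∉ U, a x = 0)
    (h : ∀ f : C₀(S, ℂ), (∀ x ∉ U, f x = 0) → ofC0 f a = 0) : a = 0 :=
  norm_le_zero_iff.1 <| norm_le_of_forall_norm_ofC0_le hU ha fun f hf _ => by rw [h f hf, norm_zero]

end Pairing

/-! ### The Riesz representation by exhaustion with open sets -/

section Riesz

variable {S : Type*} [TopologicalSpace S] [T2Space S] [LocallyCompactSpace S]

/-- On the functions vanishing off the open set `U`, the functional `φ` is integration against the
element `a` of `ℓ¹(S)`, which is supported in `U`. -/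
structure RepresentsOn (φ : StrongDual ℂ C₀(S, ℂ)) (U : Set S) (a : SemigroupL1 S) : Prop where
  isOpen : IsOpen U
  eq_zero : ∀ x ∉ U, a x = 0
  eq_ofC0 : ∀ f : C₀(S, ℂ), (∀ x ∉ U, f x = 0) → φ f = ofC0 f a

namespace RepresentsOn

variable {φ : StrongDual ℂ C₀(S, ℂ)} {U V : Set S} {a b : SemigroupL1 S}

/-- The bound does not depend on `U`, which makes the function glued along a chain summable. -/
theorem norm_le (h : RepresentsOn φ U a) : ‖a‖ ≤ ‖φ‖ :=
  norm_le_of_forall_norm_ofC0_le h.isOpen h.eq_zero fun f hf hfn => by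
    rw [← h.eq_ofC0 f hf]
    exact φ.le_of_opNorm_le_of_le le_rfl hfn |>.trans_eq (mul_one _)

/-- Representing elements are unique and restrict to smaller open sets. -/
theorem eqOn (h : RepresentsOn φ U a) (h' : RepresentsOn φ V b) (hUV : U ⊆ V) :
    ∀ x ∈ U, a x = b x := by
  classical
  -- The truncation of `b` to `U`: then `a - c` lives on `U` and pairs to zero with every function
  -- vanishing off `U`.
  let c : SemigroupL1 S := SemigroupL1.mk (U.indicator fun s => b s)
    ((summable_norm b).of_nonneg_of_le (fun _ => norm_nonneg _) fun s =>
      norm_indicator_le_norm_self _ _)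
  have hc : ∀ x ∈ U, c x = b x := fun x hx => Set.indicator_of_mem hx _
  have hc0 : ∀ x ∉ U, c x = 0 := fun x hx => Set.indicator_of_notMem hx _
  have hac : a - c = 0 := by
    refine eq_zero_of_forall_ofC0_eq_zero h.isOpen (fun x hx => ?_) fun f hf => ?_
    · change a x - c x = 0
      rw [h.eq_zero x hx, hc0 x hx, sub_zero]
    · rw [map_sub, ← h.eq_ofC0 f hf, h'.eq_ofC0 f fun x hx => hf x fun hxU => hx (hUV hxU),
        ofC0_congr hc hf, sub_self]
  intro x hx
  rw [← hc x hx, sub_eq_zero.1 hac]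

/-- Representations on the members of a chain glue to one on the union. -/
theorem sUnion {c : Set (Set S)} (hc : IsChain (· ⊆ ·) c) (hne : c.Nonempty)
    (h : ∀ U ∈ c, ∃ a, RepresentsOn φ U a) : ∃ a, RepresentsOn φ (⋃₀ c) a := by
  classical
  choose! α hα using h
  have hagree : ∀ U ∈ c, ∀ V ∈ c, ∀ x ∈ U, x ∈ V → α U x = α V x := fun U hU V hV x hxU hxV => by
    rcases hc.total hU hV with hUV | hVU
    · exact (hα U hU).eqOn (hα V hV) hUV x hxU
    · exact ((hα V hV).eqOn (hα U hU) hVU x hxV).symm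
  let g : S → ℂ := fun x => if hx : ∃ U ∈ c, x ∈ U then α hx.choose x else 0
  have hg : ∀ U ∈ c, ∀ x ∈ U, g x = α U x := fun U hU x hxU => by
    have hx : ∃ U ∈ c, x ∈ U := ⟨U, hU, hxU⟩
    simp only [g, dif_pos hx]
    exact hagree _ hx.choose_spec.1 U hU x hx.choose_spec.2 hxU
  have hg0 : ∀ x ∉ ⋃₀ c, g x = 0 := fun x hx => dif_neg fun ⟨U, hU, hxU⟩ => hx ⟨U, hU, hxU⟩
  -- A finite part of the union lies in one member of the chain, so each finite sum of `‖g s‖` is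
  -- bounded by the norm of one `α U`.
  have hfin : ∀ F : Finset S, ∃ U ∈ c, ∀ x ∈ F, x ∈ ⋃₀ c → x ∈ U := fun F => by
    induction F using Finset.induction_on with
    | empty => exact ⟨hne.some, hne.some_mem, by simp⟩
    | insert y F _ ih =>
      obtain ⟨U, hU, hFU⟩ := ih
      by_cases hy : y ∈ ⋃₀ c
      · obtain ⟨V, hV, hyV⟩ := hy
        obtain ⟨W, hW, hUW, hVW⟩ := hc.directedOn U hU V hV
        refine ⟨W, hW, fun x hx hxc => ?_⟩
        rcases Finset.mem_insert.1 hx with rfl | hx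
        · exact hVW hyV
        · exact hUW (hFU x hx hxc)
      · refine ⟨U, hU, fun x hx hxc => ?_⟩
        rcases Finset.mem_insert.1 hx with rfl | hx
        · exact absurd hxc hy
        · exact hFU x hx hxc
  have hgs : Summable fun s => ‖g s‖ := by
    refine summable_of_sum_le (fun _ => norm_nonneg _) (c := ‖φ‖) fun F => ?_
    obtain ⟨U, hU, hFU⟩ := hfin F
    refine le_trans (Finset.sum_le_sum fun x hx => ?_)
      (((summable_norm (α U)).sum_le_tsum F fun _ _ => norm_nonneg _).trans
        ((norm_eq_tsum (α U)).symm.le.trans (hα U hU).norm_le))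
    by_cases hxc : x ∈ ⋃₀ c
    · rw [hg U hU x (hFU x hx hxc)]
    · rw [hg0 x hxc, norm_zero]
      exact norm_nonneg _
  refine ⟨SemigroupL1.mk g hgs, isOpen_sUnion fun U hU => (hα U hU).isOpen, hg0, fun f hf => ?_⟩
  refine eq_of_forall_dist_le fun ε hε => ?_
  -- Replacing `f` by a function within `ε / M` changes the two functionals by at most `ε` in total;
  -- the summand 1 keeps `M` positive.
  set M := ‖φ‖ + ‖SemigroupL1.mk g hgs‖ + 1 with hM
  have hMpos : 0 < M := by positivity
  have hδ : 0 < ε / M := div_pos hε hMpos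
  have hK := ZeroAtInftyContinuousMap.isCompact_le_norm f hδ
  -- By compactness one member of the chain contains the set where `f` is not small. Cutting `f` off
  -- inside that member reduces to a representation already known.
  obtain ⟨U, hU, hKU⟩ : ∃ U ∈ c, {x | ε / M ≤ ‖f x‖} ⊆ U := by
    have : Nonempty c := hne.to_subtype
    have hcov : {x | ε / M ≤ ‖f x‖} ⊆ ⋃ U : c, (U : Set S) := fun x hx => by
      rw [← Set.sUnion_eq_iUnion]
      by_contra hxc
      have hx' : ε / M ≤ ‖f x‖ := hx
      rw [hf x hxc, norm_zero] at hx'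
      exact hδ.not_ge hx'
    obtain ⟨U, hU⟩ := hK.elim_directed_cover (fun U : c => (U : Set S))
      (fun U => (hα U U.2).isOpen) hcov hc.directedOn.directed_val
    exact ⟨U, U.2, hU⟩
  obtain ⟨χ, hχ1, hχ0, -, hχn⟩ := ZeroAtInftyContinuousMap.exists_bump hK (hα U hU).isOpen hKU
  have hfχ : ‖f - f * χ‖ ≤ ε / M := ZeroAtInftyContinuousMap.norm_le hδ.le fun x => by
    have hx : (f - f * χ) x = f x * (1 - χ x) := by
      rw [ZeroAtInftyContinuousMap.sub_apply, ZeroAtInftyContinuousMap.mul_apply]; ring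
    rw [hx, norm_mul]
    rcases le_or_gt (ε / M) ‖f x‖ with h | h
    · rw [hχ1 x h, sub_self, norm_zero, mul_zero]
      exact hδ.le
    · exact (mul_le_of_le_one_right (norm_nonneg _) (hχn x)).trans h.le
  have hU0 : ∀ x ∉ U, (f * χ) x = 0 := fun x hx => by
    rw [ZeroAtInftyContinuousMap.mul_apply, hχ0 x hx, mul_zero]
  have heq : φ (f * χ) = ofC0 (f * χ) (SemigroupL1.mk g hgs) := by
    rw [(hα U hU).eq_ofC0 _ hU0]
    exact ofC0_congr (fun x hx => (hg U hU x hx).symm) hU0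
  have hsplit : φ f - ofC0 f (SemigroupL1.mk g hgs) =
      φ (f - f * χ) - ofC0 (f - f * χ) (SemigroupL1.mk g hgs) := by
    rw [map_sub, ofC0_sub_apply, heq]; ring
  rw [dist_eq_norm, hsplit]
  calc _ ≤ ‖φ (f - f * χ)‖ + ‖ofC0 (f - f * χ) (SemigroupL1.mk g hgs)‖ := norm_sub_le _ _
    _ ≤ ‖φ‖ * (ε / M) + (ε / M) * ‖SemigroupL1.mk g hgs‖ := by
        refine add_le_add (φ.le_of_opNorm_le_of_le le_rfl hfχ) ?_
        exact (ofC0 _).le_of_opNorm_le_of_le ((norm_ofC0_le _).trans hfχ) le_rfl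
    _ ≤ M * (ε / M) := by rw [hM]; nlinarith
    _ = ε := mul_div_cancel₀ _ hMpos.ne'

/-- A representation on `U` extends to a neighbourhood of a relatively isolated point of the
complement of `U`. -/
theorem exists_insert (h : RepresentsOn φ U a) {x : S} (hV : IsOpen V) (hx : V ∩ Uᶜ = {x}) :
    ∃ b, RepresentsOn φ (insert x U) b := by
  classical
  have hxV : x ∈ V ∧ x ∉ U := (Set.ext_iff.1 hx x).2 rfl
  have hins : insert x U = U ∪ V := by
    ext y
    constructor
    · rintro (rfl | hy)
      · exact Or.inr hxV.1
      · exact Or.inl hy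
    · rintro (hy | hy)
      · exact Or.inr hy
      · by_cases hyU : y ∈ U
        · exact Or.inr hyU
        · exact Or.inl ((Set.ext_iff.1 hx y).1 ⟨hy, hyU⟩)
  obtain ⟨χ, hχ1, hχ0, -, -⟩ := ZeroAtInftyContinuousMap.exists_bump
    (isCompact_singleton (x := x)) hV (Set.singleton_subset_iff.2 hxV.1)
  have hχx : χ x = 1 := hχ1 x rfl
  -- The mass at `x`: `f - f x • χ` vanishes off `U`, where `a` represents `φ`, so only the defect
  -- of `a` on `χ` has to be corrected.
  let k : ℂ := φ χ - ofC0 χ a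
  refine ⟨a + k • delta x, hins ▸ h.isOpen.union hV, fun y hy => ?_, fun f hf => ?_⟩
  · rw [add_apply, smul_apply, delta_apply, h.eq_zero y fun hyU => hy (Or.inr hyU),
      if_neg fun hyx => hy (Or.inl hyx), mul_zero, add_zero]
  · have h0 : ∀ y ∉ U, (f - f x • χ) y = 0 := fun y hyU => by
      rw [ZeroAtInftyContinuousMap.sub_apply, ZeroAtInftyContinuousMap.smul_apply, smul_eq_mul]
      by_cases hyx : y = x
      · rw [hyx, hχx, mul_one, sub_self]
      · have hy : y ∉ insert x U := fun h => h.elim hyx hyU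
        rw [hf y hy, hχ0 y fun hyV => hy (hins ▸ Or.inr hyV), mul_zero, sub_zero]
    have h1 := h.eq_ofC0 _ h0
    have h2 : ofC0 (f x • χ) a = f x * ofC0 χ a :=
      DFunLike.congr_fun (map_smul (ofC0ₗᵢ S) (f x) χ) a
    rw [map_sub, ofC0_sub_apply, h2, map_smul, smul_eq_mul] at h1
    rw [map_add, map_smul, ofC0_delta, smul_eq_mul]
    simp only [k]
    linear_combination h1

end RepresentsOn

/-- Every bounded functional on `C₀(S)` is given by an element of `ℓ¹(S)` if `S` is countable. -/
theorem exists_forall_eq_ofC0 [Countable S] (φ : StrongDual ℂ C₀(S, ℂ)) :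
    ∃ a : SemigroupL1 S, ∀ f, φ f = ofC0 f a := by
  have h0 : RepresentsOn φ ∅ 0 := ⟨isOpen_empty, fun _ _ => rfl, fun f hf => by
    have : f = 0 := ZeroAtInftyContinuousMap.ext fun x => hf x (Set.notMem_empty x)
    rw [this, map_zero, map_zero]⟩
  obtain ⟨U, -, hU⟩ := zorn_subset_nonempty {U | ∃ a, RepresentsOn φ U a}
    (fun c hcs hc hne => ⟨⋃₀ c, RepresentsOn.sUnion hc hne hcs, fun _ => Set.subset_sUnion_of_mem⟩)
    ∅ ⟨0, h0⟩
  obtain ⟨a, ha⟩ := hU.prop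
  have huniv : Uᶜ = ∅ := by
    by_contra hne
    obtain ⟨x, V, hV, hx⟩ := exists_isOpen_inter_eq_singleton ha.isOpen.isClosed_compl
      (Set.nonempty_iff_ne_empty.2 hne)
    have hxU : x ∉ U := ((Set.ext_iff.1 hx x).2 rfl).2
    exact hxU (hU.le_of_ge (ha.exists_insert hV hx) (Set.subset_insert x U) (Set.mem_insert x U))
  exact ⟨a, fun f => ha.eq_ofC0 f fun x hx => absurd hx (by simpa using Set.ext_iff.1 huniv x)⟩

end Riesz

end SemigroupL1

/-! ### Self-maps preserving `C₀(S)` -/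

section Proper

variable {S : Type*} [TopologicalSpace S] [T2Space S] [LocallyCompactSpace S]

theorem isCompact_of_forall_seq_hasConvergentSubseq [Countable S] {K : Set S} (hK : IsClosed K)
    (h : ∀ t : ℕ → S, (∀ n, t n ∈ K) → HasConvergentSubseq t) : IsCompact K := by
  have := secondCountableTopology_of_countable_of_locallyCompact (S := S)
  let := TopologicalSpace.metrizableSpaceMetric S
  refine IsSeqCompact.isCompact fun t ht => ?_
  obtain ⟨φ, hφ, l, hl⟩ := h t ht
  exact ⟨l, hK.mem_of_tendsto hl (Eventually.of_forall fun n => ht _), φ, hφ, hl⟩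

theorem IsCompact.hasConvergentSubseq [Countable S] {K : Set S} (hK : IsCompact K) {t : ℕ → S}
    (h : ∀ n, t n ∈ K) : HasConvergentSubseq t := by
  have := secondCountableTopology_of_countable_of_locallyCompact (S := S)
  obtain ⟨l, -, φ, hφ, hl⟩ := hK.tendsto_subseq h
  exact ⟨φ, hφ, l, hl⟩

/-- A self-map of a countable locally compact Hausdorff space preserves `C₀` under composition if
and only if it is continuous and reflects having a convergent subsequence. -/
theorem forall_comp_mem_C0_iff [Countable S] (L : S → S) :
    (∀ f : C₀(S, ℂ), ∃ g : C₀(S, ℂ), ∀ x, g x = f (L x)) ↔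
      Continuous L ∧ ∀ t : ℕ → S, HasConvergentSubseq (fun n => L (t n)) →
        HasConvergentSubseq t := by
  constructor
  · intro h
    have hcont : Continuous L := by
      -- Take a bump `χ` at `L x` vanishing off `O`. Since `χ ∘ L` is continuous and nonzero at `x`,
      -- it is nonzero near `x`, so `L` maps nearby points into `O`.
      refine continuous_iff_continuousAt.2 fun x => tendsto_def.2 fun W hW => ?_
      obtain ⟨O, hOW, hO, hxO⟩ := mem_nhds_iff.1 hW
      obtain ⟨χ, hχ1, hχ0, -, -⟩ := ZeroAtInftyContinuousMap.exists_bump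
        (isCompact_singleton (x := L x)) hO (Set.singleton_subset_iff.2 hxO)
      obtain ⟨g, hg⟩ := h χ
      have hgx : g x ≠ 0 := by rw [hg, hχ1 _ rfl]; exact one_ne_zero
      filter_upwards [(map_continuous g).continuousAt.eventually_ne hgx] with y hy
      refine hOW ?_
      by_contra hyO
      exact hy (by rw [hg, hχ0 _ hyO])
    refine ⟨hcont, fun t ⟨φ, hφ, l, hl⟩ => ?_⟩
    obtain ⟨K, hK, hKl⟩ := exists_compact_mem_nhds l
    obtain ⟨χ, hχ1, -, -, -⟩ := ZeroAtInftyContinuousMap.exists_bump hK isOpen_univ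
      (Set.subset_univ K)
    obtain ⟨g, hg⟩ := h χ
    obtain ⟨N, hN⟩ := eventually_atTop.1 (hl.eventually hKl)
    -- After dropping `N` terms, `L (t (φ n))` stays in `K`, where `χ = 1`. So the tail of `t ∘ φ`
    -- lies in a superlevel set of `g = χ ∘ L`, which is compact.
    have hmem : ∀ n, t (φ (n + N)) ∈ {x | (1 : ℝ) ≤ ‖g x‖} := fun n => by
      have h1 : L (t (φ (n + N))) ∈ K := hN (n + N) (Nat.le_add_left N n)
      change (1 : ℝ) ≤ ‖g (t (φ (n + N)))‖
      rw [hg, hχ1 _ h1, norm_one]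
    obtain ⟨ψ, hψ, m, hm⟩ :=
      (ZeroAtInftyContinuousMap.isCompact_le_norm g one_pos).hasConvergentSubseq hmem
    exact ⟨fun n => φ (ψ n + N), fun i j hij => hφ (Nat.add_lt_add_right (hψ hij) N), m, hm⟩
  · rintro ⟨hL, ht⟩ f
    refine ⟨⟨⟨fun x => f (L x), (map_continuous f).comp hL⟩, ?_⟩, fun _ => rfl⟩
    refine ZeroAtInftyContinuousMap.tendsto_cocompact_of_isCompact_le_norm fun ε hε => ?_
    -- `L` sends a sequence in the superlevel set of `f ∘ L` into the compact superlevel set of `f`,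
    -- and the hypothesis on `L` lifts the convergent subsequence back.
    refine isCompact_of_forall_seq_hasConvergentSubseq
      (isClosed_le continuous_const ((map_continuous f).comp hL).norm) fun t htm => ht t ?_
    exact (ZeroAtInftyContinuousMap.isCompact_le_norm f hε).hasConvergentSubseq htm

end Proper

/-! ### Duality, reduction to translations, and the theorem -/

namespace SemigroupL1

variable {S : Type*} [TopologicalSpace S]

/-- Injective because `C₀(S)` separates `ℓ¹(S)`, surjective by the Riesz representation; the open
mapping theorem makes the inverse continuous. -/
theorem exists_equiv_strongDual_c0Subspace [T2Space S] [LocallyCompactSpace S] [Countable S] :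
    ∃ e : SemigroupL1 S ≃L[ℂ] StrongDual ℂ (c0Subspace S),
      ∀ (a : SemigroupL1 S) (f : c0Subspace S), e a f = f.1 a := by
  let T : SemigroupL1 S →L[ℂ] StrongDual ℂ (c0Subspace S) :=
    (ContinuousLinearMap.precomp ℂ (c0Subspace S).subtypeL).comp
      (NormedSpace.inclusionInDoubleDual ℂ (SemigroupL1 S))
  have hT : ∀ (a : SemigroupL1 S) (f : c0Subspace S), T a f = f.1 a := fun _ _ => rfl
  have hinj : T.ker = ⊥ := by
    refine (Submodule.eq_bot_iff _).2 fun a ha => ?_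
    refine eq_zero_of_forall_ofC0_eq_zero isOpen_univ (fun x hx => absurd trivial hx)
      fun f _ => ?_
    exact DFunLike.congr_fun (f := T a) ha (⟨ofC0 f, f, rfl⟩ : c0Subspace S)
  have hsurj : T.range = ⊤ := by
    refine Submodule.eq_top_iff'.2 fun φ => ?_
    obtain ⟨a, ha⟩ := exists_forall_eq_ofC0
      (φ.comp ((ofC0ₗᵢ S).toContinuousLinearMap.codRestrict (c0Subspace S) fun f => ⟨f, rfl⟩))
    refine ⟨a, ?_⟩
    ext ⟨_, f, rfl⟩
    exact (ha f).symm
  exact ⟨ContinuousLinearEquiv.ofBijective T hinj hsurj, hT⟩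

/-- Invariance of `C₀(S)` under the transpose of a bounded family of operators on `ℓ¹(S)` can be
tested on the unit vectors. -/
theorem forall_comp_mem_c0Subspace_iff
    (B : SemigroupL1 S →L[ℂ] SemigroupL1 S →L[ℂ] SemigroupL1 S) (p : S → S → S)
    (hB : ∀ s t, B (delta s) (delta t) = delta (p s t)) :
    (∀ f ∈ c0Subspace S, ∀ a, f.comp (B a) ∈ c0Subspace S) ↔
      ∀ s, ∀ f : C₀(S, ℂ), ∃ g : C₀(S, ℂ), ∀ x, g x = f (p s x) := by
  constructor
  · intro h s f
    obtain ⟨g, hg⟩ := mem_c0Subspace.1 (h (ofC0 f) ⟨f, rfl⟩ (delta s))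
    refine ⟨g, fun x => ?_⟩
    rw [← ofC0_delta, hg, ContinuousLinearMap.comp_apply, hB, ofC0_delta]
  · rintro h _ ⟨f, rfl⟩ a
    have hmem : ∀ s, (ofC0 f).comp (B (delta s)) ∈ c0Subspace S := fun s => by
      obtain ⟨g, hg⟩ := h s f
      refine ⟨g, clm_ext fun x => ?_⟩
      rw [ofC0_delta, hg, ContinuousLinearMap.comp_apply, hB, ofC0_delta]
    -- `f.comp (B a)` is the norm limit of finite combinations of the `f.comp (B (delta s))`, so
    -- closedness of the subspace suffices.
    have hsum := (hasSum_delta a).mapL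
      ((ContinuousLinearMap.postcomp (SemigroupL1 S) (ofC0 f)).comp B)
    refine isClosed_c0Subspace.mem_of_tendsto hsum (Eventually.of_forall fun F => ?_)
    refine Submodule.sum_mem _ fun s _ => ?_
    rw [map_smul]
    exact Submodule.smul_mem _ _ (hmem s)

end SemigroupL1

theorem mainTheorem4 {S : Type*} [Semigroup S] [Countable S]
    [TopologicalSpace S] [T2Space S] [LocallyCompactSpace S] :
    IsPredual (SemigroupL1.c0Subspace S) ↔
      SeparatelyContinuousMul S ∧
        ∀ (s : S) (t : ℕ → S),
          (HasConvergentSubseq (fun n => t n * s) ∨ HasConvergentSubseq (fun n => s * t n)) →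
            HasConvergentSubseq t := by
  -- Multiplication and its flip transpose to composition with left and right translations, so each
  -- bimodule condition becomes continuity and properness of one family of translations.
  have hl := SemigroupL1.forall_comp_mem_c0Subspace_iff (ContinuousLinearMap.mul ℂ (SemigroupL1 S))
    (fun s t => s * t) SemigroupL1.delta_mul_delta
  have hr := SemigroupL1.forall_comp_mem_c0Subspace_iff (ContinuousLinearMap.mul ℂ (SemigroupL1 S)).flip
    (fun s t => t * s) fun s t => SemigroupL1.delta_mul_delta t s
  simp only [forall_comp_mem_C0_iff] at hl hr
  constructor
  · intro h
    have h1 := hl.1 h.comp_mul_mem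
    have h2 := hr.1 h.comp_mul_flip_mem
    exact ⟨⟨fun {s} => (h1 s).1, fun {s} => (h2 s).1⟩,
      fun s t ht => ht.elim ((h2 s).2 t) ((h1 s).2 t)⟩
  · rintro ⟨hc, ht⟩
    exact ⟨SemigroupL1.isClosed_c0Subspace,
      hl.2 fun s => ⟨hc.continuous_const_mul, fun t h => ht s t (Or.inr h)⟩,
      hr.2 fun s => ⟨hc.continuous_mul_const, fun t h => ht s t (Or.inl h)⟩,
      SemigroupL1.exists_equiv_strongDual_c0Subspace⟩
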